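/- Let $n$ be a positive integer. For $x,y\in\mathbb{R}^n$ and $f\in L^2(\mathbb{R}^n)$ (complex-valued functions, Lebesgue measure, modulo equality almost everywhere) let $(x,y)f\in L^2(\mathbb{R}^n)$ be the function $t\mapsto e^{2\pi i\, y\cdot t}f(t+x)$, and for $\Lambda\subseteq\mathbb{R}^{2n}=\mathbb{R}^n\times\mathbb{R}^n$ let $S(f,\Lambda)=\{(x,y)f : (x,y)\in\Lambda\}$. Let $\Lambda=g+G$, where $g\in\mathbb{R}^{2n}$ and $G$ is a discrete subgroup of $\mathbb{R}^{2n}$, and let $f$ be a nonzero element of $L^2(\mathbb{R}^n)$. Then $S(f,\Lambda)$ is linearly independent over $\mathbb{C}$, where the translates are counted as a family: the elements $(x,y)f$ for distinct $(x,y)\in\Lambda$ are distinct, and the set $S(f,\Lambda)$ that they form is linearly independent over $\mathbb{C}$. -/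

import Mathlib

open MeasureTheory

noncomputable section

/-- The Hilbert space `L²(ℝⁿ)` of square integrable complex functions on `ℝⁿ` (with respect to
Lebesgue measure), modulo equality almost everywhere. -/
abbrev L2Rn (n : ℕ) : Type := Lp ℂ 2 (volume : Measure (EuclideanSpace ℝ (Fin n)))

/-- The additive group `ℝ²ⁿ`, whose elements are the pairs `(x, y)` with `x, y ∈ ℝⁿ`. -/
abbrev TFSpace (n : ℕ) : Type := EuclideanSpace ℝ (Fin n) × EuclideanSpace ℝ (Fin n)

/-- The function `t ↦ e^{2πi y·t} f(t + x)`, for a function `f : ℝⁿ → ℂ` and `p = (x, y)`. -/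
def tfShiftFun {n : ℕ} (p : TFSpace n) (f : EuclideanSpace ℝ (Fin n) → ℂ) :
    EuclideanSpace ℝ (Fin n) → ℂ :=
  fun t => Complex.exp (2 * (Real.pi : ℂ) * Complex.I * ((∑ i, p.2 i * t i : ℝ) : ℂ)) * f (t + p.1)

theorem memLp_tfShiftFun {n : ℕ} (p : TFSpace n) (f : L2Rn n) :
    MemLp (tfShiftFun p f) 2 (volume : Measure (EuclideanSpace ℝ (Fin n))) := by
  have h : MemLp (fun t => f (t + p.1)) 2 (volume : Measure (EuclideanSpace ℝ (Fin n))) :=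
    (Lp.memLp f).comp_measurePreserving (measurePreserving_add_right volume p.1)
  have hc : Continuous fun t : EuclideanSpace ℝ (Fin n) =>
      Complex.exp (2 * (Real.pi : ℂ) * Complex.I * ((∑ i, p.2 i * t i : ℝ) : ℂ)) := by
    fun_prop
  refine h.of_le (hc.aestronglyMeasurable.mul h.1) (Filter.Eventually.of_forall fun t => ?_)
  have e : 2 * (Real.pi : ℂ) * Complex.I * ((∑ i, p.2 i * t i : ℝ) : ℂ)
      = ((2 * Real.pi * ∑ i, p.2 i * t i : ℝ) : ℂ) * Complex.I := by
    push_cast; ring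
  simp only [tfShiftFun]
  rw [norm_mul, e, Complex.norm_exp_ofReal_mul_I, one_mul]

/-- The time-frequency translate `(x, y) f ∈ L²(ℝⁿ)` of `f ∈ L²(ℝⁿ)`, where `p = (x, y)`. -/
def tfShift {n : ℕ} (p : TFSpace n) (f : L2Rn n) : L2Rn n :=
  (memLp_tfShiftFun p f).toLp (tfShiftFun p f)

/-- The set `S(f, Λ) = {(x, y) f | (x, y) ∈ Λ}`. -/
def tfTranslates {n : ℕ} (f : L2Rn n) (Λ : Set (TFSpace n)) : Set (L2Rn n) :=
  {h | ∃ p ∈ Λ, h = tfShift p f}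

end

/-!
The proof tests a linear relation among the translates against Gaussians, which turns it into a
twisted convolution equation on `ℓ²(G)`; such an equation has no nonzero solution because `G` is
amenable and its twisted group algebra has no zero divisors.

Write `π(p)` for `tfShift p`. Then `π(p) π(q) = c(p, q) π(p + q)` with a unimodular bicharacter
`c` (`tfShift_tfShift`). If `∑ aₚ π(g + p) f = 0`, then applying `π(u - g)` for `u ∈ G` gives
`∑ βₚ c(u, p) π(u + p) f = 0`, where `βₚ = aₚ / c(g, p)`. Hence for every `h` the function
`φ(u) = ⟪h, π(u) f⟫` on `G` satisfies `∑ βₚ c(u, p) φ(u + p) = 0`.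

Take `h = π(q) h₀` with `h₀` a Gaussian. The Gram matrix of the vectors `π(q - u) h₀`, `u ∈ G`, is
dominated by a Gaussian in the difference of the indices (`exists_norm_inner_gaussianWindow_le`),
which is summable over the discrete group `G`, so Schur's test gives Bessel's inequality for this
family (`summable_norm_inner_sq_of_gram_le`) and `φ ∈ ℓ²(G)`. By
`eq_zero_of_orthogonal_twisted` then `φ = 0`, in particular `⟪π(q) h₀, f⟫ = φ(0) = 0` for all `q`.
The vectors `π(q) h₀` are total in `L²` by injectivity of the Fourier transform
(`eq_zero_of_inner_tfShift_gaussianWindow_eq_zero`), so `f = 0`.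

For the statement on `ℓ²(G)`, let `K` be the space of solutions and `P` the orthogonal projection
onto it. Twisted translations preserve `K`, so `τ = ‖P δ_w‖` does not depend on `w`. For finite
`F ⊆ G` the twisted convolution is injective on functions supported on `F`, because `G` has unique
sums, and its image is a `|F|`-dimensional space orthogonal to `K` inside the functions supported
on `F + B`, with `B` the support of `a`. Counting dimensions (`sum_norm_starProjection_sq_le`),
`|F + B| τ² ≤ |F + B| - |F|`, and a Følner set `F` (`exists_finset_card_add_lt`) forces `τ = 0`.
-/

open scoped InnerProductSpace Pointwise

/-! ### Projections and orthonormal families -/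

theorem sum_norm_inner_sq_of_mem_span {H ι : Type*} [NormedAddCommGroup H] [InnerProductSpace ℂ H]
    [Fintype ι] {e : ι → H} (he : Orthonormal ℂ e) {v : H}
    (hv : v ∈ Submodule.span ℂ (Set.range e)) :
    ∑ i, ‖⟪v, e i⟫_ℂ‖ ^ 2 = ‖v‖ ^ 2 := by
  obtain ⟨c, rfl⟩ := (Submodule.mem_span_range_iff_exists_fun ℂ).1 hv
  have h : (‖∑ i, c i • e i‖ ^ 2 : ℝ) = ∑ i, ‖c i‖ ^ 2 := by
    have h1 := he.inner_sum c c Finset.univ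
    rw [inner_self_eq_norm_sq_to_K] at h1
    have h2 : ∀ i, (starRingEnd ℂ) (c i) * c i = ((‖c i‖ ^ 2 : ℝ) : ℂ) := fun i => by
      rw [mul_comm, Complex.mul_conj, Complex.normSq_eq_norm_sq]
    simp only [h2] at h1
    apply Complex.ofReal_injective
    push_cast
    simpa using h1
  rw [h]
  refine Finset.sum_congr rfl fun i _ => ?_
  rw [he.inner_left_fintype]
  simp

/-- The trace of the projection onto `K`, compressed to the span of the `e i`, is at most the
codimension of a subspace `V` of that span on which the projection vanishes. -/
theorem sum_norm_starProjection_sq_le {H ι : Type*} [NormedAddCommGroup H]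
    [InnerProductSpace ℂ H] [Fintype ι] {e : ι → H} (he : Orthonormal ℂ e)
    (K V : Submodule ℂ H) [K.HasOrthogonalProjection]
    (hV : V ≤ Submodule.span ℂ (Set.range e)) (hVK : V ≤ Kᗮ) :
    ∑ i, ‖K.starProjection (e i)‖ ^ 2 ≤ Fintype.card ι - Module.finrank ℂ V := by
  have hfin : FiniteDimensional ℂ (Submodule.span ℂ (Set.range e)) :=
    FiniteDimensional.span_of_finite ℂ (Set.finite_range e)
  have : FiniteDimensional ℂ V := Submodule.finiteDimensional_of_le hV
  have hKV : K ≤ Vᗮ := Submodule.le_orthogonal_iff_le_orthogonal.1 hVK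
  let v := stdOrthonormalBasis ℂ V
  have h1 : ∀ i, ‖K.starProjection (e i)‖ ^ 2 ≤ 1 - ∑ j, ‖⟪(v j : H), e i⟫_ℂ‖ ^ 2 := fun i => by
    -- As `K ≤ Vᗮ`, the projection onto `K` is dominated by the one onto `Vᗮ`.
    have hp : K.starProjection (e i) = K.starProjection (Vᗮ.starProjection (e i)) := by
      have := Submodule.starProjection_comp_starProjection_of_le hKV
      exact (congrArg (fun T => T (e i)) this).symm
    have hle : ‖K.starProjection (e i)‖ ≤ ‖Vᗮ.starProjection (e i)‖ := by
      rw [hp]; exact K.norm_starProjection_apply_le _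
    have hs := Submodule.norm_sq_eq_add_norm_sq_projection (e i) V
    have hb : ‖V.orthogonalProjectionOnto (e i)‖ ^ 2 = ∑ j, ‖⟪(v j : H), e i⟫_ℂ‖ ^ 2 := by
      rw [← v.sum_sq_norm_inner_right]
      refine Finset.sum_congr rfl fun j _ => ?_
      rw [Submodule.inner_orthogonalProjectionOnto_eq_of_mem_left]
    have hn : ‖Vᗮ.orthogonalProjectionOnto (e i)‖ = ‖Vᗮ.starProjection (e i)‖ := rfl
    rw [he.1 i, hb, hn] at hs
    have := pow_le_pow_left₀ (norm_nonneg _) hle 2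
    linarith
  calc ∑ i, ‖K.starProjection (e i)‖ ^ 2
      ≤ ∑ i, (1 - ∑ j, ‖⟪(v j : H), e i⟫_ℂ‖ ^ 2) := Finset.sum_le_sum fun i _ => h1 i
    _ = Fintype.card ι - ∑ j, ∑ i, ‖⟪(v j : H), e i⟫_ℂ‖ ^ 2 := by
        rw [Finset.sum_sub_distrib, Finset.sum_comm]; simp
    _ = Fintype.card ι - Module.finrank ℂ V := by
        congr 1
        rw [Finset.sum_congr rfl fun j _ => sum_norm_inner_sq_of_mem_span he (hV (v j).2)]
        have : ∀ j, ‖(v j : H)‖ = 1 := fun j => v.orthonormal.1 j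
        simp [this]

/-! ### Følner sets in abelian groups -/

/-- Abelian groups satisfy Følner's condition: the `k`-fold sums of elements of `B` number at most
`(k + 1) ^ |B|`, so their growth factor cannot stay above `r⁻¹ > 1`. -/
theorem exists_finset_card_add_lt {A : Type*} [AddCommGroup A] [DecidableEq A] (B : Finset A)
    {r : ℝ} (hr0 : 0 < r) (hr1 : r < 1) :
    ∃ F : Finset A, r * (F + B).card < F.card := by
  by_contra! hcon
  -- The sums of elements of `B` with multiplicities at most `k`.
  let F : ℕ → Finset A := fun k =>
    (Fintype.piFinset fun _ : B => Finset.range (k + 1)).image fun m => ∑ b : B, m b • (b : A)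
  have hsub : ∀ k, F k + B ⊆ F (k + 1) := fun k x hx => by
    obtain ⟨y, hy, b, hb, rfl⟩ := Finset.mem_add.1 hx
    obtain ⟨m, hm, rfl⟩ := Finset.mem_image.1 hy
    refine Finset.mem_image.2 ⟨m + Pi.single ⟨b, hb⟩ 1, ?_, ?_⟩
    · simp only [Fintype.mem_piFinset, Finset.mem_range, Pi.add_apply] at hm ⊢
      intro c
      have h1 := hm c
      have h2 : (Pi.single (⟨b, hb⟩ : B) 1 : B → ℕ) c ≤ 1 := by
        rw [Pi.single_apply]; split_ifs <;> simp
      omega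
    · simp only [Pi.add_apply, add_smul, Finset.sum_add_distrib, add_right_inj]
      rw [Finset.sum_eq_single (⟨b, hb⟩ : B)] <;> simp +contextual
  have hcard : ∀ k, ((F k).card : ℝ) ≤ ((k + 1 : ℕ) : ℝ) ^ B.card := fun k => by
    have : (F k).card ≤ (k + 1) ^ B.card := by
      refine Finset.card_image_le.trans ?_
      simp [Fintype.card_piFinset]
    exact_mod_cast this
  have hgrow : ∀ k, 1 ≤ r ^ k * (F k).card := fun k => by
    induction k with
    | zero =>
      have : 0 < (F 0).card :=
        Finset.card_pos.2 ((Fintype.piFinset_nonempty.2 fun _ => by simp).image _)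
      simpa using Nat.one_le_iff_ne_zero.2 this.ne'
    | succ k ih =>
      have h1 : ((F k).card : ℝ) ≤ r * (F (k + 1)).card :=
        (hcon (F k)).trans (mul_le_mul_of_nonneg_left
          (by exact_mod_cast Finset.card_le_card (hsub k)) hr0.le)
      calc 1 ≤ r ^ k * (F k).card := ih
        _ ≤ r ^ k * (r * (F (k + 1)).card) := mul_le_mul_of_nonneg_left h1 (pow_nonneg hr0.le k)
        _ = r ^ (k + 1) * (F (k + 1)).card := by ring
  have hlim := (tendsto_pow_const_mul_const_pow_of_abs_lt_one B.card
    (abs_lt.2 ⟨by linarith, hr1⟩)).comp (Filter.tendsto_add_atTop_nat 1)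
  obtain ⟨k, hk⟩ := (hlim.eventually (gt_mem_nhds hr0)).exists
  have h2 := (hgrow k).trans (mul_le_mul_of_nonneg_left (hcard k) (pow_nonneg hr0.le k))
  have h3 := mul_le_mul_of_nonneg_left h2 hr0.le
  simp only [Function.comp_apply] at hk
  rw [pow_succ] at hk
  linarith

/-! ### Twisted convolution on an abelian group -/

/-- Twisted convolution by a nonzero finitely supported function is injective on finitely supported
functions, when the group has unique sums. -/
theorem linearIndependent_twisted {H A : Type*} [NormedAddCommGroup H] [InnerProductSpace ℂ H]
    [AddCommGroup A] [UniqueSums A] {b : A → H} (hb : Orthonormal ℂ b)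
    {B : Finset A} (hB : B.Nonempty) {α : A → ℂ} (hα : ∀ p ∈ B, α p ≠ 0)
    {d : A → A → ℂ} (hd : ∀ u v, ‖d u v‖ = 1) :
    LinearIndependent ℂ fun u => ∑ p ∈ B, (α p * d u p) • b (u + p) := by
  rw [linearIndependent_iff]
  intro k hk
  by_contra hne
  obtain ⟨u₀, hu₀, p₀, hp₀, huniq⟩ := UniqueSums.uniqueAdd_of_nonempty
    (Finsupp.support_nonempty_iff.2 hne) hB
  classical
  have h := congrArg (fun x => ⟪b (u₀ + p₀), x⟫_ℂ) hk
  simp only [Finsupp.linearCombination_apply, Finsupp.sum, inner_sum, inner_smul_right,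
    inner_zero_right, orthonormal_iff_ite.1 hb] at h
  rw [Finset.sum_eq_single_of_mem u₀ hu₀, Finset.sum_eq_single_of_mem p₀ hp₀] at h
  · have hd0 : d u₀ p₀ ≠ 0 := norm_ne_zero_iff.1 (by rw [hd]; exact one_ne_zero)
    simp [hα p₀ hp₀, hd0, Finsupp.mem_support_iff.1 hu₀] at h
  · intro p hp hpne
    rw [if_neg fun hh => hpne (huniq hu₀ hp hh.symm).2, mul_zero]
  · intro u hu hune
    rw [Finset.sum_eq_zero, mul_zero]
    intro p hp
    rw [if_neg fun hh => hune (huniq hu hp hh.symm).1, mul_zero]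

/-- Translation of the basis by `w`, with the basis vectors rescaled by unimodular factors, is
unitary. -/
theorem exists_twisted_translation {H A : Type*} [NormedAddCommGroup H] [InnerProductSpace ℂ H]
    [CompleteSpace H] [AddCommGroup A] (b : HilbertBasis A ℂ H) (w : A) {κ : A → ℂ}
    (hκ : ∀ i, ‖κ i‖ = 1) :
    ∃ U : H ≃ₗᵢ[ℂ] H, ∀ i, U (b i) = κ i • b (w + i) := by
  classical
  have hκ0 : ∀ i, κ i ≠ 0 := fun i => norm_ne_zero_iff.1 (by rw [hκ]; exact one_ne_zero)
  have ho : Orthonormal ℂ fun i => κ i • b (w + i) := by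
    rw [orthonormal_iff_ite]
    intro i j
    rw [inner_smul_left, inner_smul_right, orthonormal_iff_ite.1 b.orthonormal]
    by_cases hij : i = j
    · subst hij
      simp only [if_true, mul_one]
      rw [mul_comm, Complex.mul_conj, Complex.normSq_eq_norm_sq, hκ]; simp
    · simp [hij]
  have hsp : ⊤ ≤ (Submodule.span ℂ (Set.range fun i => κ i • b (w + i))).topologicalClosure := by
    rw [← b.dense_span]
    refine Submodule.topologicalClosure_mono (Submodule.span_le.2 ?_)
    rintro _ ⟨i, rfl⟩
    have h1 := Submodule.smul_mem _ (κ (i - w))⁻¹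
      (Submodule.subset_span (s := Set.range fun i => κ i • b (w + i)) ⟨i - w, rfl⟩)
    simpa [smul_smul, hκ0] using h1
  refine ⟨b.repr.trans (HilbertBasis.mk ho hsp).repr.symm, fun i => ?_⟩
  rw [LinearIsometryEquiv.trans_apply, b.repr_self, HilbertBasis.repr_symm_single,
    HilbertBasis.coe_mk]

/-- A square summable solution of a twisted convolution equation with nonzero finitely supported
kernel vanishes. The basis `b` plays the role of the delta functions in `ℓ²(A)`, and the equation
is stated as orthogonality to the twisted translates of the kernel. -/
theorem eq_zero_of_orthogonal_twisted {H A : Type*} [NormedAddCommGroup H]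
    [InnerProductSpace ℂ H] [CompleteSpace H] [AddCommGroup A] [UniqueSums A]
    (b : HilbertBasis A ℂ H)
    {B : Finset A} (hB : B.Nonempty) {α : A → ℂ} (hα : ∀ p ∈ B, α p ≠ 0)
    {d : A → A → ℂ} (hd : ∀ u v, ‖d u v‖ = 1)
    (hd_left : ∀ u v w, d (u + v) w = d u w * d v w)
    (hd_right : ∀ u v w, d u (v + w) = d u v * d u w) {φ : H}
    (hφ : ∀ u, ⟪∑ p ∈ B, (α p * d u p) • b (u + p), φ⟫_ℂ = 0) : φ = 0 := by
  classical
  set s : A → H := fun u => ∑ p ∈ B, (α p * d u p) • b (u + p) with hs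
  have hd0 : ∀ u v, d u v ≠ 0 := fun u v => norm_ne_zero_iff.1 (by rw [hd]; exact one_ne_zero)
  set S := Submodule.span ℂ (Set.range s) with hS
  set K := Sᗮ with hK
  have hUs : ∀ w, ∃ U : H ≃ₗᵢ[ℂ] H, U (b 0) = d w 0 • b w ∧
      ∀ u, U (s u) = d w u • s (w + u) := by
    intro w
    obtain ⟨U, hU⟩ := exists_twisted_translation b w (hd w)
    refine ⟨U, by simp [hU], fun u => ?_⟩
    simp only [hs, map_sum, map_smul, hU, Finset.smul_sum, smul_smul, hd_left, hd_right,
      add_assoc]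
    refine Finset.sum_congr rfl fun p _ => ?_
    congr 1; ring
  have hconst : ∀ w, ‖K.starProjection (b w)‖ = ‖K.starProjection (b 0)‖ := by
    intro w
    obtain ⟨U, hU0, hU⟩ := hUs w
    have hSU : S.map (U.toLinearEquiv : H →ₗ[ℂ] H) = S := by
      rw [hS, Submodule.map_span]
      apply le_antisymm <;> rw [Submodule.span_le]
      · rintro _ ⟨_, ⟨u, rfl⟩, rfl⟩
        change U (s u) ∈ _
        rw [hU]
        exact Submodule.smul_mem _ _ (Submodule.subset_span ⟨_, rfl⟩)
      · rintro _ ⟨u, rfl⟩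
        have h1 := Submodule.smul_mem _ (d w (u - w))⁻¹ (Submodule.subset_span
          (s := (U.toLinearEquiv : H →ₗ[ℂ] H) '' Set.range s) ⟨_, ⟨u - w, rfl⟩, rfl⟩)
        change (d w (u - w))⁻¹ • U (s (u - w)) ∈ _ at h1
        rw [hU, smul_smul, inv_mul_cancel₀ (hd0 _ _), one_smul, add_sub_cancel] at h1
        exact h1
    have hKU : K.map (U.toLinearEquiv : H →ₗ[ℂ] H) = K := by
      conv_rhs => rw [hK, ← hSU]
      exact Submodule.map_orthogonal_equiv S U
    have h1 := Submodule.starProjection_map_apply U K (U (b 0))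
    rw [U.symm_apply_apply] at h1
    have h2 : K.starProjection (U (b 0)) = U (K.starProjection (b 0)) := by
      rw [← h1]; congr 1; simp only [hKU]
    have h3 := congrArg norm h2
    rw [hU0, map_smul, norm_smul, hd, one_mul, U.norm_map] at h3
    exact h3
  have hτ : ‖K.starProjection (b 0)‖ = 0 := by
    by_contra hne
    set τ := ‖K.starProjection (b 0)‖ with hτdef
    have hτ0 : 0 < τ := lt_of_le_of_ne (norm_nonneg _) (Ne.symm hne)
    have hτ1 : τ ≤ 1 := by
      have := K.norm_starProjection_apply_le (b 0)
      rwa [b.orthonormal.1 0] at this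
    -- The slack `τ ^ 2 / 2` keeps `r` positive when `τ = 1`.
    obtain ⟨F, hF⟩ := exists_finset_card_add_lt B (r := 1 - τ ^ 2 / 2) (by nlinarith)
      (by nlinarith)
    let e : ↥(F + B) → H := fun i => b i
    have he : Orthonormal ℂ e := b.orthonormal.comp _ Subtype.val_injective
    have hli : LinearIndependent ℂ fun u : F => s u :=
      (linearIndependent_twisted b.orthonormal hB hα hd).comp _ Subtype.val_injective
    have hle := sum_norm_starProjection_sq_le he K (Submodule.span ℂ (Set.range fun u : F => s u))
      (by
        rw [Submodule.span_le]
        rintro _ ⟨u, rfl⟩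
        refine Submodule.sum_mem _ fun p hp => Submodule.smul_mem _ _ (Submodule.subset_span ?_)
        exact ⟨⟨_, Finset.add_mem_add u.2 hp⟩, rfl⟩)
      (by
        refine le_trans (Submodule.span_mono ?_) S.le_orthogonal_orthogonal
        rintro _ ⟨u, rfl⟩
        exact ⟨u, rfl⟩)
    rw [finrank_span_eq_card hli] at hle
    simp only [e, hconst, Finset.sum_const, Finset.card_univ, Fintype.card_coe,
      nsmul_eq_mul] at hle
    have : (0 : ℝ) ≤ (F + B).card := Nat.cast_nonneg _
    nlinarith
  have hφK : φ ∈ K := by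
    rw [hK, Submodule.mem_orthogonal]
    intro x hx
    induction hx using Submodule.span_induction with
    | mem x hx => obtain ⟨u, rfl⟩ := hx; exact hφ u
    | zero => simp
    | add x y _ _ hx hy => rw [inner_add_left, hx, hy, add_zero]
    | smul c x _ hx => rw [inner_smul_left, hx, mul_zero]
  apply b.repr.injective
  ext w
  rw [b.repr_apply_apply, map_zero]
  have h0 : K.starProjection (b w) = 0 := norm_eq_zero.1 ((hconst w).trans hτ)
  rw [← Submodule.starProjection_eq_self_iff.2 hφK, ← Submodule.inner_starProjection_left_eq_right,
    h0, inner_zero_left]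
  rfl

/-! ### A Bessel inequality and Gaussian sums over discrete subgroups -/

/-- Bessel's inequality, up to a constant, for a family whose Gram matrix is dominated by a summable
function of the difference of the indices (Schur's test). -/
theorem summable_norm_inner_sq_of_gram_le {H A : Type*} [NormedAddCommGroup H]
    [InnerProductSpace ℂ H] [AddCommGroup A] {v : A → H} {k : A → ℝ} (hk : Summable k)
    (hv : ∀ i j, ‖⟪v i, v j⟫_ℂ‖ ≤ k (j - i)) (f : H) :
    Summable fun i => ‖⟪v i, f⟫_ℂ‖ ^ 2 := by
  have hk0 : ∀ i, 0 ≤ k i := fun i => by simpa using (norm_nonneg _).trans (hv 0 i)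
  set κ := ∑' i, k i
  have hκ0 : 0 ≤ κ := tsum_nonneg hk0
  refine summable_of_sum_le (c := κ * ‖f‖ ^ 2) (fun _ => by positivity) fun F => ?_
  have hrow : ∀ i, ∑ j ∈ F, k (j - i) ≤ κ := fun i => by
    have h1 : Summable fun j => k (j - i) := (Equiv.subRight i).summable_iff.2 hk
    exact (h1.sum_le_tsum F fun _ _ => hk0 _).trans_eq ((Equiv.subRight i).tsum_eq k)
  have hcol : ∀ j, ∑ i ∈ F, k (j - i) ≤ κ := fun j => by
    have h1 : Summable fun i => k (j - i) := (Equiv.subLeft j).summable_iff.2 hk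
    exact (h1.sum_le_tsum F fun _ _ => hk0 _).trans_eq ((Equiv.subLeft j).tsum_eq k)
  set c : A → ℂ := fun i => ⟪v i, f⟫_ℂ
  set s := ∑ i ∈ F, ‖c i‖ ^ 2 with hs
  have hs0 : 0 ≤ s := Finset.sum_nonneg fun _ _ => by positivity
  set x := ∑ i ∈ F, c i • v i with hx
  have hxf : ⟪x, f⟫_ℂ = (s : ℂ) := by
    rw [hx, hs, sum_inner]
    push_cast
    refine Finset.sum_congr rfl fun i _ => ?_
    rw [inner_smul_left, mul_comm, Complex.mul_conj, Complex.normSq_eq_norm_sq]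
    push_cast; rfl
  have hxx : ‖x‖ ^ 2 ≤ κ * s := by
    have h1 : ‖x‖ ^ 2 = ‖⟪x, x⟫_ℂ‖ := by
      rw [inner_self_eq_norm_sq_to_K]; simp
    rw [h1]
    conv_lhs => rw [hx, sum_inner]
    simp only [inner_sum, inner_smul_left, inner_smul_right]
    calc ‖∑ i ∈ F, ∑ j ∈ F, c j * ((starRingEnd ℂ) (c i) * ⟪v i, v j⟫_ℂ)‖
        ≤ ∑ i ∈ F, ∑ j ∈ F, (‖c i‖ ^ 2 / 2 * k (j - i) + ‖c j‖ ^ 2 / 2 * k (j - i)) := by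
          refine (norm_sum_le _ _).trans (Finset.sum_le_sum fun i _ => (norm_sum_le _ _).trans
            (Finset.sum_le_sum fun j _ => ?_))
          rw [norm_mul, norm_mul, RCLike.norm_conj]
          have h2 := mul_le_mul_of_nonneg_left (hv i j)
            (mul_nonneg (norm_nonneg (c j)) (norm_nonneg (c i)))
          have h3 := mul_nonneg (sq_nonneg (‖c i‖ - ‖c j‖)) (hk0 (j - i))
          nlinarith
      _ = ∑ i ∈ F, ‖c i‖ ^ 2 / 2 * ∑ j ∈ F, k (j - i)
          + ∑ j ∈ F, ‖c j‖ ^ 2 / 2 * ∑ i ∈ F, k (j - i) := by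
          simp only [Finset.sum_add_distrib, Finset.mul_sum]
          congr 1
          exact Finset.sum_comm
      _ ≤ ∑ i ∈ F, ‖c i‖ ^ 2 / 2 * κ + ∑ j ∈ F, ‖c j‖ ^ 2 / 2 * κ := by
          gcongr
          · exact hrow _
          · exact hcol _
      _ = κ * s := by
          rw [← Finset.sum_mul, ← Finset.sum_div, ← hs]; ring
  have h4 : s ≤ ‖x‖ * ‖f‖ := by
    have := norm_inner_le_norm (𝕜 := ℂ) x f
    rwa [hxf, Complex.norm_real, Real.norm_of_nonneg hs0] at this
  rcases hs0.eq_or_lt with h0 | h0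
  · rw [← h0]; positivity
  · have h5 : s * s ≤ (κ * ‖f‖ ^ 2) * s := by
      have := mul_self_le_mul_self hs0 h4
      nlinarith [mul_le_mul_of_nonneg_right hxx (sq_nonneg ‖f‖)]
    exact le_of_mul_le_mul_right h5 h0

theorem summable_exp_neg_mul_norm_sq {E : Type*} [NormedAddCommGroup E] [NormedSpace ℝ E]
    [FiniteDimensional ℝ E] (G : AddSubgroup E) [hG : DiscreteTopology G] {c : ℝ} (hc : 0 < c) :
    Summable fun z : G => Real.exp (-(c * ‖(z : E)‖ ^ 2)) := by
  let L : Submodule ℤ E := AddSubgroup.toIntSubmodule G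
  have : DiscreteTopology L := hG
  let m := Module.finrank ℤ L + 1
  have h1 : Summable fun z : L => ‖z‖⁻¹ ^ (2 * m) :=
    ZLattice.summable_norm_pow_inv L (2 * m) (by omega)
  have h2 : Summable fun z : G => (m.factorial / c ^ m) * ‖z‖⁻¹ ^ (2 * m) := h1.mul_left _
  refine Summable.of_norm_bounded_eventually h2 ?_
  filter_upwards [(Set.finite_singleton (0 : G)).compl_mem_cofinite] with z hz
  have hz0 : 0 < ‖(z : E)‖ := norm_pos_iff.2 fun h => hz (Subtype.ext h)
  rw [Real.norm_of_nonneg (Real.exp_nonneg _), Real.exp_neg]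
  have h3 := Real.pow_div_factorial_le_exp (c * ‖(z : E)‖ ^ 2) (by positivity) m
  have h4 : 0 < (c * ‖(z : E)‖ ^ 2) ^ m / m.factorial := by positivity
  refine (inv_anti₀ h4 h3).trans_eq ?_
  rw [inv_div, mul_pow, ← pow_mul, inv_pow, div_mul_eq_div_div, div_eq_mul_inv]
  rfl

/-! ### Injectivity of the Fourier transform -/

/-- Injectivity of the Fourier transform on `L¹`: pairing with a test function `g` is pairing the
Fourier transform of `F` with the inverse Fourier transform of `g`. -/
theorem ae_eq_zero_of_fourier_eq_zero {V : Type*} [NormedAddCommGroup V] [InnerProductSpace ℝ V]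
    [FiniteDimensional ℝ V] [MeasurableSpace V] [BorelSpace V] {F : V → ℂ}
    (hF : Integrable F) (h : ∀ y, ∫ t, Real.fourierChar (-⟪t, y⟫_ℝ) • F t = 0) :
    F =ᵐ[volume] 0 := by
  refine ae_eq_zero_of_integral_contDiff_smul_eq_zero hF.locallyIntegrable fun g hg hgs => ?_
  have hgs' : HasCompactSupport fun x => (g x : ℂ) := hgs.comp_left Complex.ofReal_zero
  let ψ : SchwartzMap V ℂ := hgs'.toSchwartzMap (Complex.ofRealCLM.contDiff.comp hg)
  have h1 := VectorFourier.integral_fourierIntegral_smul_eq_flip (μ := volume) (ν := volume)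
    (L := innerₗ V) Real.continuous_fourierChar continuous_inner
    (FourierTransform.fourierInv ψ).integrable hF
  have h2 : ∀ x, VectorFourier.fourierIntegral Real.fourierChar volume (innerₗ V).flip F x = 0 := by
    intro x
    rw [← h x]
    simp only [VectorFourier.fourierIntegral]
    refine integral_congr_ae (Filter.Eventually.of_forall fun t => ?_)
    simp [real_inner_comm]
  simp only [h2, smul_zero, integral_zero] at h1
  rw [← h1]
  refine integral_congr_ae (Filter.Eventually.of_forall fun x => ?_)
  have h3 : FourierTransform.fourier (FourierTransform.fourierInv ψ) x = ψ x := by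
    rw [FourierTransform.fourier_fourierInv_eq]
  have h4 : VectorFourier.fourierIntegral Real.fourierChar volume (innerₗ V)
      (FourierTransform.fourierInv ψ) x = (g x : ℂ) := h3
  beta_reduce
  rw [h4]
  exact RCLike.real_smul_eq_coe_smul (K := ℂ) _ _

/-! ### Time-frequency translations -/

/-- The unimodular factor `e^{2πi x·y'}`, for `p = (x, y)` and `q = (x', y')`, by which
`tfShift p ∘ tfShift q` differs from `tfShift (p + q)`. It is additive in each variable. -/
noncomputable def tfCocycle {n : ℕ} (p q : TFSpace n) : ℂ :=
  Complex.exp (2 * (Real.pi : ℂ) * Complex.I * ((∑ i, q.2 i * p.1 i : ℝ) : ℂ))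

theorem norm_exp_two_pi_I (r : ℝ) :
    ‖Complex.exp (2 * (Real.pi : ℂ) * Complex.I * (r : ℂ))‖ = 1 := by
  have e : 2 * (Real.pi : ℂ) * Complex.I * (r : ℂ) = ((2 * Real.pi * r : ℝ) : ℂ) * Complex.I := by
    push_cast; ring
  rw [e, Complex.norm_exp_ofReal_mul_I]

theorem norm_tfCocycle {n : ℕ} (p q : TFSpace n) : ‖tfCocycle p q‖ = 1 := norm_exp_two_pi_I _

theorem tfCocycle_ne_zero {n : ℕ} (p q : TFSpace n) : tfCocycle p q ≠ 0 := Complex.exp_ne_zero _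

theorem tfCocycle_add_left {n : ℕ} (p p' q : TFSpace n) :
    tfCocycle (p + p') q = tfCocycle p q * tfCocycle p' q := by
  simp only [tfCocycle, ← Complex.exp_add, ← mul_add, ← Complex.ofReal_add,
    ← Finset.sum_add_distrib]
  rfl

theorem tfCocycle_add_right {n : ℕ} (p q q' : TFSpace n) :
    tfCocycle p (q + q') = tfCocycle p q * tfCocycle p q' := by
  simp only [tfCocycle, ← Complex.exp_add, ← mul_add, ← Complex.ofReal_add,
    ← Finset.sum_add_distrib, ← add_mul]
  rfl

theorem coeFn_tfShift {n : ℕ} (p : TFSpace n) (f : L2Rn n) :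
    tfShift p f =ᵐ[volume] tfShiftFun p f :=
  MemLp.coeFn_toLp _

theorem tfShift_add {n : ℕ} (p : TFSpace n) (f g : L2Rn n) :
    tfShift p (f + g) = tfShift p f + tfShift p g := by
  apply Lp.ext
  filter_upwards [coeFn_tfShift p (f + g), coeFn_tfShift p f, coeFn_tfShift p g,
    Lp.coeFn_add (tfShift p f) (tfShift p g),
    (measurePreserving_add_right volume p.1).quasiMeasurePreserving.ae (Lp.coeFn_add f g)]
    with t h1 h2 h3 h4 h5
  rw [h1, h4, Pi.add_apply, h2, h3]
  simp only [tfShiftFun]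
  rw [h5, Pi.add_apply, mul_add]

theorem tfShift_smul {n : ℕ} (p : TFSpace n) (c : ℂ) (f : L2Rn n) :
    tfShift p (c • f) = c • tfShift p f := by
  apply Lp.ext
  filter_upwards [coeFn_tfShift p (c • f), coeFn_tfShift p f,
    Lp.coeFn_smul c (tfShift p f),
    (measurePreserving_add_right volume p.1).quasiMeasurePreserving.ae (Lp.coeFn_smul c f)]
    with t h1 h2 h3 h4
  rw [h1, h3, Pi.smul_apply, h2]
  simp only [tfShiftFun]
  rw [h4, Pi.smul_apply, smul_eq_mul, smul_eq_mul]
  ring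

theorem norm_tfShift {n : ℕ} (p : TFSpace n) (f : L2Rn n) : ‖tfShift p f‖ = ‖f‖ := by
  rw [tfShift, Lp.norm_toLp, Lp.norm_def]
  congr 1
  rw [← eLpNorm_comp_measurePreserving (Lp.aestronglyMeasurable f)
    (measurePreserving_add_right volume p.1)]
  refine eLpNorm_congr_norm_ae (Filter.Eventually.of_forall fun t => ?_)
  simp only [tfShiftFun, norm_mul, norm_exp_two_pi_I, one_mul, Function.comp_apply]

/-- The time-frequency translation by `p` as a linear isometry of `L²(ℝⁿ)`. -/
noncomputable def tfShiftₗᵢ {n : ℕ} (p : TFSpace n) : L2Rn n →ₗᵢ[ℂ] L2Rn n where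
  toFun := tfShift p
  map_add' := tfShift_add p
  map_smul' := tfShift_smul p
  norm_map' := norm_tfShift p

theorem inner_tfShift_tfShift {n : ℕ} (p : TFSpace n) (f g : L2Rn n) :
    ⟪tfShift p f, tfShift p g⟫_ℂ = ⟪f, g⟫_ℂ :=
  (tfShiftₗᵢ p).inner_map_map f g

theorem tfShift_tfShift {n : ℕ} (p q : TFSpace n) (f : L2Rn n) :
    tfShift p (tfShift q f) = tfCocycle p q • tfShift (p + q) f := by
  apply Lp.ext
  filter_upwards [coeFn_tfShift p (tfShift q f), coeFn_tfShift (p + q) f,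
    Lp.coeFn_smul (tfCocycle p q) (tfShift (p + q) f),
    (measurePreserving_add_right volume p.1).quasiMeasurePreserving.ae (coeFn_tfShift q f)]
    with t h1 h2 h3 h4
  rw [h1, h3, Pi.smul_apply, h2]
  simp only [tfShiftFun] at h4 ⊢
  rw [h4, smul_eq_mul, tfCocycle, ← mul_assoc, ← mul_assoc, ← Complex.exp_add, ← Complex.exp_add,
    Prod.fst_add, Prod.snd_add, add_assoc, ← mul_add, ← mul_add, ← Complex.ofReal_add,
    ← Complex.ofReal_add, ← Finset.sum_add_distrib, ← Finset.sum_add_distrib]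
  refine congrArg (fun r : ℝ => Complex.exp (2 * (Real.pi : ℂ) * Complex.I * (r : ℂ))
    * f (t + (p.1 + q.1))) (Finset.sum_congr rfl fun i _ => ?_)
  simp only [PiLp.add_apply]
  ring

theorem tfShift_zero {n : ℕ} (f : L2Rn n) : tfShift 0 f = f := by
  apply Lp.ext
  filter_upwards [coeFn_tfShift 0 f] with t h1
  rw [h1]
  simp [tfShiftFun]

theorem norm_inner_tfShift {n : ℕ} (p q : TFSpace n) (h f : L2Rn n) :
    ‖⟪tfShift q h, tfShift p f⟫_ℂ‖ = ‖⟪tfShift (q - p) h, f⟫_ℂ‖ := by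
  rw [← inner_tfShift_tfShift p (tfShift (q - p) h) f, tfShift_tfShift, inner_smul_left, norm_mul,
    RCLike.norm_conj, norm_tfCocycle, one_mul, add_sub_cancel]

/-! ### The Gaussian window -/

theorem memLp_gaussian (n : ℕ) : MemLp (fun t : EuclideanSpace ℝ (Fin n) =>
    Complex.exp (-(Real.pi : ℂ) * (‖t‖ : ℂ) ^ 2)) 2 volume := by
  rw [memLp_two_iff_integrable_sq_norm (by fun_prop)]
  have h := (GaussianFourier.integrable_cexp_neg_mul_sq_norm_add
    (V := EuclideanSpace ℝ (Fin n)) (b := 2 * (Real.pi : ℂ)) (by simp [Real.pi_pos]) 0 0).norm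
  refine h.congr (Filter.Eventually.of_forall fun t => ?_)
  simp only [Complex.norm_exp]
  rw [← Real.exp_nat_mul]
  congr 1
  norm_cast
  simp
  norm_cast
  ring

/-- The Gaussian `t ↦ e^{-π ‖t‖²}` as an element of `L²(ℝⁿ)`. -/
noncomputable def gaussianWindow (n : ℕ) : L2Rn n := (memLp_gaussian n).toLp _

theorem coeFn_gaussianWindow {n : ℕ} : gaussianWindow n =ᵐ[volume]
    fun t => Complex.exp (-(Real.pi : ℂ) * (‖t‖ : ℂ) ^ 2) := MemLp.coeFn_toLp _

theorem sum_mul_eq_inner {n : ℕ} (y t : EuclideanSpace ℝ (Fin n)) : ∑ i, y i * t i = ⟪y, t⟫_ℝ := by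
  rw [PiLp.inner_apply]
  exact Finset.sum_congr rfl fun i _ => by simp [mul_comm]

/-- The ambiguity function of the Gaussian has Gaussian decay. The norm on `TFSpace n` is the
maximum of the two Euclidean norms, hence the inequality. -/
theorem exists_norm_inner_gaussianWindow_le (n : ℕ) : ∃ C : ℝ, ∀ p : TFSpace n,
    ‖⟪gaussianWindow n, tfShift p (gaussianWindow n)⟫_ℂ‖
      ≤ C * Real.exp (-(Real.pi / 2 * ‖p‖ ^ 2)) := by
  refine ⟨‖((Real.pi : ℂ) / (2 * Real.pi)) ^
    (Module.finrank ℝ (EuclideanSpace ℝ (Fin n)) / 2 : ℂ)‖, fun p => ?_⟩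
  let φ : EuclideanSpace ℝ (Fin n) → ℂ := fun t =>
    Complex.exp (-(Real.pi : ℂ) * (‖t‖ : ℂ) ^ 2)
      * (Complex.exp (2 * (Real.pi : ℂ) * Complex.I * ((∑ i, p.2 i * t i : ℝ) : ℂ))
      * Complex.exp (-(Real.pi : ℂ) * (‖t + p.1‖ : ℂ) ^ 2))
  have h1 : ⟪gaussianWindow n, tfShift p (gaussianWindow n)⟫_ℂ = ∫ t, φ t := by
    rw [L2.inner_def]
    refine integral_congr_ae ?_
    filter_upwards [coeFn_gaussianWindow (n := n), coeFn_tfShift p (gaussianWindow n),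
      (measurePreserving_add_right volume p.1).quasiMeasurePreserving.ae
        (coeFn_gaussianWindow (n := n))] with t h1 h2 h3
    rw [h1, h2, tfShiftFun, h3, RCLike.inner_apply', ← Complex.exp_conj]
    simp [φ]
  -- Centring at `-x / 2` makes the product of the two Gaussians a Gaussian in `t` times one in `x`.
  have h2 : ∀ t, φ (t - (1 / 2 : ℝ) • p.1)
      = Complex.exp (-(Real.pi / 2 * ‖p.1‖ ^ 2 : ℝ) - Real.pi * Complex.I * (⟪p.2, p.1⟫_ℝ : ℝ)) *
        Complex.exp (-(2 * (Real.pi : ℂ)) * (‖t‖ : ℂ) ^ 2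
          + (2 * Real.pi * Complex.I) * ⟪p.2, t⟫_ℝ) := by
    intro t
    have e1 : t - (1 / 2 : ℝ) • p.1 + p.1 = t + (1 / 2 : ℝ) • p.1 := by module
    have e2 := norm_sub_sq_real t ((1 / 2 : ℝ) • p.1)
    have e3 := norm_add_sq_real t ((1 / 2 : ℝ) • p.1)
    simp only [inner_smul_right, norm_smul, Real.norm_of_nonneg one_half_pos.le] at e2 e3
    simp only [φ, ← Complex.exp_add, e1, sum_mul_eq_inner, inner_sub_right, inner_smul_right]
    rw [← Complex.ofReal_pow, ← Complex.ofReal_pow, e2, e3]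
    congr 1
    push_cast
    ring
  rw [h1, ← integral_sub_right_eq_self φ ((1 / 2 : ℝ) • p.1)]
  simp only [h2]
  rw [integral_const_mul, GaussianFourier.integral_cexp_neg_mul_sq_norm_add (by simp [Real.pi_pos]),
    mul_left_comm, norm_mul, ← Complex.exp_add, Complex.norm_exp]
  refine mul_le_mul_of_nonneg_left (Real.exp_le_exp.2 ?_) (norm_nonneg _)
  have e4 : (2 * (Real.pi : ℂ) * Complex.I) ^ 2 * (‖p.2‖ : ℂ) ^ 2 / (4 * (2 * Real.pi))
      = ((-(Real.pi / 2 * ‖p.2‖ ^ 2) : ℝ) : ℂ) := by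
    have : (Real.pi : ℂ) ≠ 0 := by exact_mod_cast Real.pi_ne_zero
    field_simp
    push_cast
    simp
    ring
  have e5 : ‖p‖ ^ 2 ≤ ‖p.1‖ ^ 2 + ‖p.2‖ ^ 2 := by
    rw [Prod.norm_def]
    rcases max_cases ‖p.1‖ ‖p.2‖ with ⟨h, _⟩ | ⟨h, _⟩ <;> rw [h] <;>
      nlinarith [sq_nonneg ‖p.1‖, sq_nonneg ‖p.2‖]
  rw [e4, Complex.add_re, Complex.sub_re, Complex.ofReal_re]
  have e6 : ((Real.pi : ℂ) * Complex.I * (⟪p.2, p.1⟫_ℝ : ℝ)).re = 0 := by simp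
  rw [e6, ← Complex.ofReal_neg, Complex.ofReal_re]
  nlinarith [Real.pi_pos]

/-- The time-frequency translates of the Gaussian are total in `L²(ℝⁿ)`: the modulations alone
already determine the Fourier transform of the product of `f` and the Gaussian. -/
theorem eq_zero_of_inner_tfShift_gaussianWindow_eq_zero {n : ℕ} {f : L2Rn n}
    (h : ∀ q : TFSpace n, ⟪tfShift q (gaussianWindow n), f⟫_ℂ = 0) : f = 0 := by
  have hF : Integrable fun t => Complex.exp (-(Real.pi : ℂ) * (‖t‖ : ℂ) ^ 2) * f t :=
    (memLp_gaussian n).integrable_mul (Lp.memLp f)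
  have h0 := ae_eq_zero_of_fourier_eq_zero hF fun y => by
    rw [← h (0, y), L2.inner_def]
    refine integral_congr_ae ?_
    filter_upwards [coeFn_tfShift (0, y) (gaussianWindow n), coeFn_gaussianWindow (n := n)]
      with t h1 h2
    rw [h1, tfShiftFun, sum_mul_eq_inner, add_zero, h2, RCLike.inner_apply', map_mul,
      ← Complex.exp_conj, ← Complex.exp_conj, Circle.smul_def, Real.fourierChar_apply,
      real_inner_comm, smul_eq_mul, ← mul_assoc]
    congr 2
    · simp only [map_mul, Complex.conj_ofReal, Complex.conj_I, map_ofNat]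
      push_cast
      ring_nf
    · simp
  apply Lp.ext
  filter_upwards [h0, Lp.coeFn_zero ℂ 2 (volume : Measure (EuclideanSpace ℝ (Fin n)))]
    with t h1 h2
  rw [h2]
  exact (mul_eq_zero.1 h1).resolve_left (Complex.exp_ne_zero _)

/-! ### Linear independence of the translates -/

theorem uniqueSums_addSubgroup {E : Type*} [AddCommGroup E] [Module ℝ E] (G : AddSubgroup E) :
    UniqueSums G := by
  let _ : Module ℚ E := Module.compHom E (algebraMap ℚ ℝ)
  exact UniqueSums.of_injective_addHom (G.subtype : G →ₙ+ E) Subtype.val_injective inferInstance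

theorem memℓp_inner_tfShift {n : ℕ} (G : AddSubgroup (TFSpace n)) [DiscreteTopology G]
    (q : TFSpace n) (f : L2Rn n) :
    Memℓp (fun u : G => ⟪tfShift q (gaussianWindow n), tfShift (u : TFSpace n) f⟫_ℂ) 2 := by
  obtain ⟨C, hC⟩ := exists_norm_inner_gaussianWindow_le n
  have h1 : Summable fun u : G => ‖⟪tfShift (q - (u : TFSpace n)) (gaussianWindow n), f⟫_ℂ‖ ^ 2 := by
    refine summable_norm_inner_sq_of_gram_le
      (k := fun u : G => C * Real.exp (-(Real.pi / 2 * ‖(u : TFSpace n)‖ ^ 2)))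
      ((summable_exp_neg_mul_norm_sq G (by positivity)).mul_left C) (fun i j => ?_) f
    rw [norm_inner_tfShift, norm_inner_symm]
    rw [sub_sub_sub_cancel_left, ← AddSubgroup.coe_sub]
    exact hC _
  refine memℓp_gen ?_
  simpa [norm_inner_tfShift] using h1

theorem linearIndependent_tfShift {n : ℕ} (G : AddSubgroup (TFSpace n)) [DiscreteTopology G]
    (g : TFSpace n) {f : L2Rn n} (hf : f ≠ 0) :
    LinearIndependent ℂ fun p : G => tfShift (g + (p : TFSpace n)) f := by
  have := uniqueSums_addSubgroup G
  rw [linearIndependent_iff]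
  intro a ha
  by_contra hne
  refine hf (eq_zero_of_inner_tfShift_gaussianWindow_eq_zero fun q => ?_)
  -- `φ(u) = ⟪π(q) h₀, π(u) f⟫`, a solution of a twisted convolution equation.
  let φ : lp (fun _ : G => ℂ) 2 := ⟨_, memℓp_inner_tfShift G q f⟩
  let b : HilbertBasis G ℂ (lp (fun _ : G => ℂ) 2) := default
  have hb : ∀ u, ⟪b u, φ⟫_ℂ = ⟪tfShift q (gaussianWindow n), tfShift (u : TFSpace n) f⟫_ℂ :=
    fun u => (b.repr_apply_apply φ u).symm
  let β : G → ℂ := fun p => a p * (tfCocycle g p)⁻¹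
  have hrel : ∀ u : G, ∑ p ∈ a.support, (β p * tfCocycle (u : TFSpace n) p) •
      tfShift ((u + p : G) : TFSpace n) f = 0 := fun u => by
    have h1 := congrArg (tfShiftₗᵢ ((u : TFSpace n) - g)) ha
    rw [Finsupp.linearCombination_apply, Finsupp.sum, map_sum, map_zero] at h1
    have hcancel : tfCocycle ((u : TFSpace n) - g) g ≠ 0 := tfCocycle_ne_zero _ _
    rw [← smul_right_injective _ (inv_ne_zero hcancel) |>.eq_iff, smul_zero, Finset.smul_sum] at h1
    rw [← h1]
    refine Finset.sum_congr rfl fun p _ => ?_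
    rw [map_smul]
    change _ = (tfCocycle _ _)⁻¹ • a p •
      tfShift ((u : TFSpace n) - g) (tfShift (g + (p : TFSpace n)) f)
    rw [tfShift_tfShift, smul_smul, smul_smul, tfCocycle_add_right,
      show ((u : TFSpace n) - g + (g + (p : TFSpace n))) = ((u + p : G) : TFSpace n) by
        push_cast; abel]
    congr 1
    have h2 : tfCocycle (u : TFSpace n) p = tfCocycle ((u : TFSpace n) - g) p * tfCocycle g p := by
      rw [← tfCocycle_add_left, sub_add_cancel]
    have := tfCocycle_ne_zero g p
    simp only [β, h2]
    field_simp
  have hφ : φ = 0 := by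
    refine eq_zero_of_orthogonal_twisted b (B := a.support) (Finsupp.support_nonempty_iff.2 hne)
      (α := fun p => (starRingEnd ℂ) (β p))
      (d := fun u p => (starRingEnd ℂ) (tfCocycle (u : TFSpace n) p)) (fun p hp => ?_)
      (fun u v => ?_) (fun u v w => ?_) (fun u v w => ?_) (fun u => ?_)
    · simpa [β, tfCocycle_ne_zero] using hp
    · rw [RCLike.norm_conj, norm_tfCocycle]
    · simp [tfCocycle_add_left]
    · simp [tfCocycle_add_right]
    · have h1 := congrArg (fun x => ⟪tfShift q (gaussianWindow n), x⟫_ℂ) (hrel u)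
      simp only [inner_sum, inner_smul_right, inner_zero_right] at h1
      simp only [sum_inner, inner_smul_left, hb, map_mul, Complex.conj_conj]
      exact h1
  have h0 := hb 0
  rw [hφ, inner_zero_right, AddSubgroup.coe_zero, tfShift_zero] at h0
  exact h0.symm

theorem proposition1p3 (n : ℕ) (hn : 0 < n)
    (G : AddSubgroup (TFSpace n)) (hG : DiscreteTopology G)
    (g : TFSpace n) (Λ : Set (TFSpace n)) (hΛ : Λ = (fun h => g + h) '' (G : Set (TFSpace n)))
    (f : L2Rn n) (hf : f ≠ 0) :
    Set.InjOn (fun p => tfShift p f) Λ ∧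
      LinearIndepOn ℂ (id : L2Rn n → L2Rn n) (tfTranslates f Λ) := by
  subst hΛ
  have h := linearIndependent_tfShift G g hf
  constructor
  · rintro _ ⟨p, hp, rfl⟩ _ ⟨q, hq, rfl⟩ hpq
    have hinj := h.injective
    exact congrArg (fun r : G => g + (r : TFSpace n))
      (hinj (a₁ := ⟨p, hp⟩) (a₂ := ⟨q, hq⟩) hpq)
  · have hr : tfTranslates f ((fun h => g + h) '' (G : Set (TFSpace n)))
        = Set.range fun p : G => tfShift (g + (p : TFSpace n)) f := by
      ext x
      constructor
      · rintro ⟨_, ⟨p, hp, rfl⟩, rfl⟩; exact ⟨⟨p, hp⟩, rfl⟩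
      · rintro ⟨p, rfl⟩; exact ⟨_, ⟨p, p.2, rfl⟩, rfl⟩
    rw [hr]
    exact h.linearIndepOn_id
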